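/- Let $X$ be a nonempty set and let $\mathcal{A}$ be an arbitrary field of subsets of $X$ (a family of subsets of $X$ containing $\emptyset$ and closed under finite unions and complements). Let $$\mathcal{M}(X,\mathcal{A})=\{f:X\to\mathbb{R} : f^{-1}(U)\in\mathcal{A}\text{ for every open } U\subseteq\mathbb{R}\}.$$ Then the following are equivalent. (i) $\mathcal{M}(X,\mathcal{A})$ is a ring under the pointwise operations (that is, a subring of $\mathbb{R}^X$), and this ring is self-injective: for every ideal $I$ of $R=\mathcal{M}(X,\mathcal{A})$, every $R$-module homomorphism $I\to R$ extends to an $R$-module homomorphism $R\to R$. (ii) $\mathcal{A}$ is complete (every subset of $\mathcal{A}$ has a supremum in the Boolean algebra $\mathcal{A}$ ordered by inclusion; this supremum need not be the union) and $\mathfrak{c}^+$-additive (the union of any family of at most $\mathfrak{c}=2^{\aleph_0}$ members of $\mathcal{A}$ belongs to $\mathcal{A}$). In particular, whenever $\mathcal{M}(X,\mathcal{A})$ is a ring, it is self-injective if and only if $\mathcal{A}$ is complete and $\mathfrak{c}^+$-additive. -/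

import Mathlib

open MeasureTheory
open scoped Cardinal

universe u

namespace FieldOfSets

variable {X : Type u}

/-- The set `M(X, 𝒜)` of all functions `f : X → ℝ` such that `f ⁻¹' U ∈ 𝒜` for every open `U ⊆ ℝ`.
If `𝒜` is merely a field of sets, this set need not be closed under pointwise addition. -/
def measurableFunctions (𝒜 : Set (Set X)) : Set (X → ℝ) :=
  {f | ∀ U : Set ℝ, IsOpen U → f ⁻¹' U ∈ 𝒜}

/-- A commutative ring `R` is self-injective if every `R`-linear map from an ideal of `R` to `R`
extends to an `R`-linear map `R → R`. -/
def IsSelfInjective (R : Type u) [CommRing R] : Prop :=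
  Module.Baer R R

/-- `𝒜` is complete as a Boolean algebra: every subset of `𝒜` has a supremum in `𝒜`, ordered by
inclusion. (The supremum need not be the union.) -/
def IsComplete (𝒜 : Set (Set X)) : Prop :=
  ∀ K : Set 𝒜, ∃ A : 𝒜, IsLUB K A

/-- `𝒜` is `κ⁺`-additive: it is closed under unions of at most `κ` of its elements. -/
def IsSuccAdditive (κ : Cardinal.{u}) (𝒜 : Set (Set X)) : Prop :=
  ∀ 𝒮 : Set (Set X), 𝒮 ⊆ 𝒜 → #𝒮 ≤ κ → ⋃₀ 𝒮 ∈ 𝒜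

end FieldOfSets

namespace FieldOfSets

variable {X : Type u} {𝒜 : Set (Set X)}

/-! For any `h : X → ℝ`, multiplication by `h` is a homomorphism on the ideal of those `f` with `f *
h ∈ R`. Self-injectivity turns it into multiplication by some `r ∈ R`
(`exists_eqOn_of_isSelfInjective`). Taking `h` to be the indicator of a union yields suprema; taking
distinct constants on disjoint sets yields unions. Conversely, a homomorphism `φ` is multiplication
by the quotients `φ f / f`, which agree where defined. Completeness encloses the places where they
equal `t` in one member of `𝒜`, and additivity glues these members into a measurable `r`. -/

theorem indicator_const_mem_measurableFunctions (h𝒜 : IsSetAlgebra 𝒜) {B : Set X} (hB : B ∈ 𝒜)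
    (c : ℝ) : B.indicator (fun _ => c) ∈ measurableFunctions 𝒜 := by
  classical
  intro U _
  rw [Set.indicator_const_preimage_eq_union]
  refine h𝒜.union_mem ?_ ?_
  · split_ifs
    exacts [hB, h𝒜.empty_mem]
  · split_ifs
    exacts [h𝒜.compl_mem hB, h𝒜.empty_mem]

theorem preimage_singleton_mem (h𝒜 : IsSetAlgebra 𝒜) {f : X → ℝ}
    (hf : f ∈ measurableFunctions 𝒜) (t : ℝ) : f ⁻¹' {t} ∈ 𝒜 := by
  have h := h𝒜.compl_mem (hf {t}ᶜ isOpen_compl_singleton)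
  rwa [Set.preimage_compl, compl_compl] at h

theorem support_mem {f : X → ℝ} (hf : f ∈ measurableFunctions 𝒜) : f.support ∈ 𝒜 :=
  hf {0}ᶜ isOpen_compl_singleton

/-- In a self-injective ring of functions, every function `h` agrees with an element of the ring on
all sets on which the restriction of `h` belongs to the ring. -/
theorem exists_eqOn_of_isSelfInjective (h𝒜 : IsSetAlgebra 𝒜) {R : Subring (X → ℝ)}
    (hR : (R : Set (X → ℝ)) = measurableFunctions 𝒜) (hinj : IsSelfInjective R) (h : X → ℝ) :
    ∃ r ∈ measurableFunctions 𝒜, ∀ B ∈ 𝒜, B.indicator h ∈ measurableFunctions 𝒜 →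
      Set.EqOn r h B := by
  let I : Ideal R :=
    { carrier := {f | (f : X → ℝ) * h ∈ R}
      add_mem' := fun {a b} ha hb => by
        simpa [add_mul] using R.add_mem ha hb
      zero_mem' := by simp [R.zero_mem]
      smul_mem' := fun c f hf => by
        simpa [mul_assoc] using R.mul_mem c.2 hf }
  let φ : I →ₗ[R] R :=
    { toFun := fun f => ⟨((f : R) : X → ℝ) * h, f.2⟩
      map_add' := fun a b => by ext x; simp [add_mul]
      map_smul' := fun c a => by ext x; simp [mul_assoc] }
  obtain ⟨ψ, hψ⟩ := hinj I φ
  refine ⟨(ψ 1 : R), hR ▸ (ψ 1).2, fun B hB hBh x hx => ?_⟩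
  have h1 : B.indicator (fun _ => (1 : ℝ)) ∈ R := by
    rw [← SetLike.mem_coe, hR]
    exact indicator_const_mem_measurableFunctions h𝒜 hB 1
  have hmul : B.indicator (fun _ => (1 : ℝ)) * h = B.indicator h := by
    ext y
    by_cases hy : y ∈ B <;> simp [hy]
  have hmem : (⟨_, h1⟩ : R) ∈ I := by
    change B.indicator (fun _ => (1 : ℝ)) * h ∈ R
    rwa [hmul, ← SetLike.mem_coe, hR]
  have key := hψ ⟨_, h1⟩ hmem
  have hlin : ψ ⟨_, h1⟩ = ⟨_, h1⟩ * ψ 1 := by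
    rw [← smul_eq_mul, ← map_smul, smul_eq_mul, mul_one]
  rw [hlin] at key
  have := congrFun (congrArg Subtype.val key) x
  simpa [φ, hx] using this

theorem isComplete_of_isSelfInjective (h𝒜 : IsSetAlgebra 𝒜) {R : Subring (X → ℝ)}
    (hR : (R : Set (X → ℝ)) = measurableFunctions 𝒜) (hinj : IsSelfInjective R) :
    IsComplete 𝒜 := by
  intro K
  obtain ⟨r, hr, hrB⟩ := exists_eqOn_of_isSelfInjective h𝒜 hR hinj
    ((⋃ B ∈ K, (B : Set X)).indicator fun _ => 1)
  -- `r` is 1 on each member of `K` and 0 off every upper bound of `K`.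
  refine ⟨⟨r.support, support_mem hr⟩, fun B hB x hx => ?_, fun D hD x hx => ?_⟩
  · have hBK : (B : Set X) ⊆ ⋃ B ∈ K, (B : Set X) := Set.subset_biUnion_of_mem hB
    have := hrB B B.2 (by
      rw [Set.indicator_indicator, Set.inter_eq_left.2 hBK]
      exact indicator_const_mem_measurableFunctions h𝒜 B.2 1) hx
    rw [Set.indicator_of_mem (hBK hx)] at this
    simp [this]
  · by_contra hxD
    have hKD : (⋃ B ∈ K, (B : Set X)) ⊆ D := Set.iUnion₂_subset fun B hB => hD hB
    have := hrB (D : Set X)ᶜ (h𝒜.compl_mem D.2) (by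
      rw [Set.indicator_indicator, Set.inter_comm, ← Set.sdiff_eq, Set.sdiff_eq_empty.2 hKD]
      exact indicator_const_mem_measurableFunctions h𝒜 h𝒜.empty_mem 1) hxD
    exact hx (this.trans (Set.indicator_of_notMem (fun h => hxD (hKD h)) _))

/-- The supremum adds no point `x`: as `e` is injective, the fibre of `r` through `x` meets at most
one `B i`. Removing that one leaves a set whose complement is a smaller upper bound. -/
theorem iUnion_mem_of_pairwise_disjoint (h𝒜 : IsSetAlgebra 𝒜) {R : Subring (X → ℝ)}
    (hR : (R : Set (X → ℝ)) = measurableFunctions 𝒜) (hinj : IsSelfInjective R) {ι : Type*}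
    {e : ι → ℝ} (he : e.Injective) {B : ι → Set X} (hB : ∀ i, B i ∈ 𝒜)
    (hdisj : ∀ i j x, x ∈ B i → x ∈ B j → i = j) : ⋃ i, B i ∈ 𝒜 := by
  classical
  let h : X → ℝ := fun x => if hx : ∃ i, x ∈ B i then e hx.choose else 0
  have hh : ∀ i, ∀ x ∈ B i, h x = e i := fun i x hx => by
    have hx' : ∃ i, x ∈ B i := ⟨i, hx⟩
    simp only [h, dif_pos hx']
    rw [hdisj _ _ _ hx'.choose_spec hx]
  obtain ⟨r, hr, hrB⟩ := exists_eqOn_of_isSelfInjective h𝒜 hR hinj h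
  have hre : ∀ i, ∀ x ∈ B i, r x = e i := fun i x hx => by
    rw [hrB (B i) (hB i) ?_ hx, hh i x hx]
    rw [Set.indicator_congr (hh i)]
    exact indicator_const_mem_measurableFunctions h𝒜 (hB i) (e i)
  obtain ⟨S, hS, hSmin⟩ := isComplete_of_isSelfInjective h𝒜 hR hinj {C | ∃ i, (C : Set X) = B i}
  suffices ⋃ i, B i = S from this ▸ S.2
  refine (Set.iUnion_subset fun i => hS (a := ⟨B i, hB i⟩) ⟨i, rfl⟩).antisymm fun x hx => ?_
  by_contra hxB
  simp only [Set.mem_iUnion, not_exists] at hxB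
  -- a set of `𝒜` containing `x` and disjoint from every `B i`
  obtain ⟨C, hC, hxC, hCB⟩ : ∃ C ∈ 𝒜, x ∈ C ∧ ∀ i, ∀ y ∈ B i, y ∉ C := by
    have hfib := preimage_singleton_mem h𝒜 hr (r x)
    by_cases hi : ∃ i, e i = r x
    · obtain ⟨i, hi⟩ := hi
      refine ⟨r ⁻¹' {r x} \ B i, h𝒜.sdiff_mem hfib (hB i), ⟨rfl, hxB i⟩, fun j y hy hyC => ?_⟩
      have hji : j = i := he ((hre j y hy).symm.trans (hyC.1.trans hi.symm))
      exact hyC.2 (hji ▸ hy)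
    · exact ⟨_, hfib, rfl, fun j y hy hyC => hi ⟨j, (hre j y hy).symm.trans hyC⟩⟩
  refine hSmin (a := ⟨Cᶜ, h𝒜.compl_mem hC⟩) ?_ hx hxC
  rintro ⟨_, _⟩ ⟨i, rfl⟩ y hy
  exact hCB i y hy

/-- Well-order the family and subtract from each set its predecessors; transfinite induction keeps
the differences in `𝒜`, and reals label them. -/
theorem isSuccAdditive_of_isSelfInjective (h𝒜 : IsSetAlgebra 𝒜) {R : Subring (X → ℝ)}
    (hR : (R : Set (X → ℝ)) = measurableFunctions 𝒜) (hinj : IsSelfInjective R) :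
    IsSuccAdditive 𝔠 𝒜 := by
  classical
  intro 𝒮 h𝒮 hcard
  obtain ⟨e⟩ : Nonempty (𝒮 ↪ ℝ) := by
    rw [← Cardinal.lift_mk_le', Cardinal.mk_real, Cardinal.lift_continuum,
      ← Cardinal.lift_continuum.{0, u}]
    exact Cardinal.lift_le.2 hcard
  let lt : 𝒮 → 𝒮 → Prop := WellOrderingRel
  have hwf : WellFounded lt := IsWellFounded.wf
  -- it suffices to treat the initial segments of `𝒮`
  have main : ∀ T : Set 𝒮, (∀ s ∈ T, ∀ t, lt t s → t ∈ T) →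
      (∀ s ∈ T, ⋃ t ∈ {t | lt t s}, (t : Set X) ∈ 𝒜) → ⋃ t ∈ T, (t : Set X) ∈ 𝒜 := by
    intro T hT hU
    let B : T → Set X := fun s => (s : Set X) \ ⋃ t ∈ {t | lt t s}, (t : Set X)
    have hBT : ⋃ t ∈ T, (t : Set X) = ⋃ s, B s := by
      ext x
      simp only [Set.mem_iUnion]
      constructor
      · rintro ⟨s, hs, hx⟩
        let Q : Set 𝒮 := {s | x ∈ (s : Set X)}
        have hQ : Q.Nonempty := ⟨s, hx⟩
        have hmT : hwf.min Q hQ ∈ T := by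
          rcases trichotomous_of lt (hwf.min Q hQ) s with h | h | h
          · exact hT s hs _ h
          · exact h ▸ hs
          · exact absurd h (hwf.not_lt_min Q hx)
        refine ⟨⟨_, hmT⟩, hwf.min_mem Q hQ, ?_⟩
        simp only [Set.mem_iUnion, not_exists]
        exact fun t ht hxt => hwf.not_lt_min Q hxt ht
      · rintro ⟨s, hx⟩
        exact ⟨s, s.2, hx.1⟩
    rw [hBT]
    refine iUnion_mem_of_pairwise_disjoint h𝒜 hR hinj
      (e.injective.comp Subtype.val_injective)
      (fun s => h𝒜.sdiff_mem (h𝒮 s.1.2) (hU s s.2)) fun i j x hi hj => ?_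
    rcases trichotomous_of lt i.1 j.1 with h | h | h
    · exact absurd (Set.mem_biUnion (show i.1 ∈ {t | lt t j.1} from h) hi.1) hj.2
    · exact Subtype.ext h
    · exact absurd (Set.mem_biUnion (show j.1 ∈ {t | lt t i.1} from h) hj.1) hi.2
  have hseg : ∀ s, ⋃ t ∈ {t | lt t s}, (t : Set X) ∈ 𝒜 := fun s =>
    hwf.induction s fun s ih => main {t | lt t s} (fun a ha b hb => trans_of lt hb ha) ih
  have := main Set.univ (fun _ _ _ _ => trivial) fun s _ => hseg s
  rwa [Set.biUnion_univ, ← Set.sUnion_eq_iUnion] at this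

theorem IsSuccAdditive.iUnion_mem (hadd : IsSuccAdditive.{u} 𝔠 𝒜) (T : Set ℝ) {B : ℝ → Set X}
    (hB : ∀ t, B t ∈ 𝒜) : ⋃ t ∈ T, B t ∈ 𝒜 := by
  rw [← Set.sUnion_image]
  refine hadd _ (Set.image_subset_iff.2 fun t _ => hB t) ?_
  have h := (Cardinal.mk_image_le_lift (f := B) (s := T)).trans
    (Cardinal.lift_le.2 (Cardinal.mk_set_le T))
  simpa [Cardinal.mk_real] using h

theorem preimage_mem_of_isSuccAdditive (hadd : IsSuccAdditive.{u} 𝔠 𝒜) {f : X → ℝ}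
    (hf : ∀ t, f ⁻¹' {t} ∈ 𝒜) (T : Set ℝ) : f ⁻¹' T ∈ 𝒜 := by
  rw [← Set.biUnion_preimage_singleton]
  exact hadd.iUnion_mem T hf

/-- If `𝒜` is `𝔠⁺`-additive then any operation on `ℝ` preserves `measurableFunctions 𝒜`. -/
theorem comp₂_mem_measurableFunctions (h𝒜 : IsSetAlgebra 𝒜) (hadd : IsSuccAdditive.{u} 𝔠 𝒜)
    (op : ℝ → ℝ → ℝ) {f g : X → ℝ} (hf : f ∈ measurableFunctions 𝒜)
    (hg : g ∈ measurableFunctions 𝒜) : (fun x => op (f x) (g x)) ∈ measurableFunctions 𝒜 := by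
  intro U _
  have : (fun x => op (f x) (g x)) ⁻¹' U =
      ⋃ t ∈ (Set.univ : Set ℝ), f ⁻¹' {t} ∩ g ⁻¹' {s | op t s ∈ U} := by
    ext x
    simp
  rw [this]
  exact hadd.iUnion_mem _ fun t => h𝒜.inter_mem (preimage_singleton_mem h𝒜 hf t)
    (preimage_mem_of_isSuccAdditive hadd (preimage_singleton_mem h𝒜 hg) _)

/-- The ring of measurable functions of a `𝔠⁺`-additive field of sets. -/
def measurableSubring (h𝒜 : IsSetAlgebra 𝒜) (hadd : IsSuccAdditive.{u} 𝔠 𝒜) :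
    Subring (X → ℝ) where
  carrier := measurableFunctions 𝒜
  mul_mem' := comp₂_mem_measurableFunctions h𝒜 hadd (· * ·)
  add_mem' := comp₂_mem_measurableFunctions h𝒜 hadd (· + ·)
  neg_mem' hf := comp₂_mem_measurableFunctions h𝒜 hadd (fun a _ => -a) hf hf
  one_mem' := by
    simpa using! indicator_const_mem_measurableFunctions h𝒜 h𝒜.univ_mem 1
  zero_mem' := by
    simpa using! indicator_const_mem_measurableFunctions h𝒜 h𝒜.univ_mem 0

/-- Suprema of two families in `𝒜` are disjoint if the families are elementwise disjoint. -/
theorem disjoint_of_isLUB (h𝒜 : IsSetAlgebra 𝒜) {K L : Set 𝒜} {A B : 𝒜} (hA : IsLUB K A)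
    (hB : IsLUB L B) (h : ∀ C ∈ K, ∀ D ∈ L, Disjoint (C : Set X) D) :
    Disjoint (A : Set X) B := by
  have h1 : ∀ C ∈ K, Disjoint (C : Set X) B := fun C hC => by
    rw [← Set.subset_compl_iff_disjoint_left]
    obtain ⟨-, hmin⟩ := hB
    exact hmin (a := ⟨(C : Set X)ᶜ, h𝒜.compl_mem C.2⟩) fun D hD =>
      Set.subset_compl_iff_disjoint_left.2 (h C hC D hD)
  rw [← Set.subset_compl_iff_disjoint_right]
  obtain ⟨-, hmin⟩ := hA
  exact hmin (a := ⟨(B : Set X)ᶜ, h𝒜.compl_mem B.2⟩) fun C hC =>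
    Set.subset_compl_iff_disjoint_right.2 (h1 C hC)

/-- A family of disjoint members of `𝒜` indexed by `ℝ` is contained in the family of fibres of a
measurable function. -/
theorem exists_measurable_eq_of_disjoint (h𝒜 : IsSetAlgebra 𝒜) (hadd : IsSuccAdditive.{u} 𝔠 𝒜)
    {A : ℝ → Set X} (hA : ∀ t, A t ∈ 𝒜) (hdisj : ∀ s t x, x ∈ A s → x ∈ A t → s = t) :
    ∃ r ∈ measurableFunctions 𝒜, ∀ t, ∀ x ∈ A t, r x = t := by
  classical
  let r : X → ℝ := fun x => if hx : ∃ t, x ∈ A t then hx.choose else 0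
  have hr : ∀ t, ∀ x ∈ A t, r x = t := fun t x hx => by
    have hx' : ∃ t, x ∈ A t := ⟨t, hx⟩
    simp only [r, dif_pos hx']
    exact hdisj _ _ _ hx'.choose_spec hx
  have hr0 : ∀ x, (∀ t, x ∉ A t) → r x = 0 := fun x hx => dif_neg (not_exists.2 hx)
  refine ⟨r, fun U _ => preimage_mem_of_isSuccAdditive hadd (fun t => ?_) U, hr⟩
  -- The default value 0 can make the fibre over 0 larger than `A 0`.
  rcases eq_or_ne t 0 with rfl | ht
  · have : r ⁻¹' {0} = (⋃ t ∈ ({0}ᶜ : Set ℝ), A t)ᶜ := by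
      ext x
      simp only [Set.mem_preimage, Set.mem_singleton_iff, Set.mem_compl_iff, Set.mem_iUnion,
        not_exists]
      refine ⟨fun hx t ht hxt => ht ((hr t x hxt).symm.trans hx), fun hx => ?_⟩
      by_cases hx' : ∃ t, x ∈ A t
      · obtain ⟨t, hxt⟩ := hx'
        rw [hr t x hxt]
        by_contra ht
        exact hx t ht hxt
      · exact hr0 x (not_exists.1 hx')
    rw [this]
    exact h𝒜.compl_mem (hadd.iUnion_mem _ hA)
  · have : r ⁻¹' {t} = A t := by
      ext x
      refine ⟨fun hx => ?_, hr t x⟩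
      by_cases hx' : ∃ t, x ∈ A t
      · obtain ⟨s, hxs⟩ := hx'
        have hst : s = t := (hr s x hxs).symm.trans hx
        exact hst ▸ hxs
      · exact absurd ((Set.mem_singleton_iff.1 hx).symm.trans (hr0 x (not_exists.1 hx'))) ht
    exact this ▸ hA t

theorem isSelfInjective_measurableSubring (h𝒜 : IsSetAlgebra 𝒜) (hcomp : IsComplete 𝒜)
    (hadd : IsSuccAdditive.{u} 𝔠 𝒜) : IsSelfInjective (measurableSubring h𝒜 hadd) := by
  let R := measurableSubring h𝒜 hadd
  intro (I : Ideal R) (φ : I →ₗ[R] R)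
  let v : I → X → ℝ := fun f => ((f : R) : X → ℝ)
  let w : I → X → ℝ := fun f => (φ f : X → ℝ)
  have hcross : ∀ f g x, v f x * w g x = v g x * w f x := fun f g x => by
    have h : (f : R) • φ g = (g : R) • φ f := by
      rw [← map_smul, ← map_smul]
      congr 1
      ext1
      exact mul_comm _ _
    exact congrFun (congrArg Subtype.val h) x
  have hzero : ∀ f x, v f x = 0 → w f x = 0 := fun f x hx => by
    -- The indicator of the zero set of `f` annihilates `f`, hence also `φ f`.
    let E : Set X := v f ⁻¹' {0}
    have hE : E ∈ 𝒜 := preimage_singleton_mem h𝒜 (f : R).2 0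
    let e : R := ⟨_, indicator_const_mem_measurableFunctions h𝒜 hE 1⟩
    have h0 : e • f = 0 := by
      ext y
      by_cases hy : y ∈ E
      · have : v f y = 0 := hy
        change E.indicator (fun _ => (1 : ℝ)) y * v f y = 0
        rw [this, mul_zero]
      · change E.indicator (fun _ => (1 : ℝ)) y * v f y = 0
        rw [Set.indicator_of_notMem hy, zero_mul]
    have h : e • φ f = 0 := by rw [← map_smul, h0, map_zero]
    have h' : E.indicator (fun _ => (1 : ℝ)) x * w f x = 0 :=
      congrFun (congrArg Subtype.val h) x
    rwa [Set.indicator_of_mem (show x ∈ E from hx), one_mul] at h'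
  -- the set on which the quotient of `φ f` by `f` is defined and equal to `t`
  let P : I → ℝ → Set X := fun f t => (v f).support ∩ (fun x => w f x / v f x) ⁻¹' {t}
  have hP : ∀ f t, P f t ∈ 𝒜 := fun f t =>
    h𝒜.inter_mem (support_mem (f : R).2) (preimage_singleton_mem h𝒜
      (comp₂_mem_measurableFunctions h𝒜 hadd (· / ·) (φ f).2 (f : R).2) t)
  choose A hA using fun t => hcomp {C | ∃ f, (C : Set X) = P f t}
  -- Suprema may exceed unions, yet stay disjoint for distinct `t`.
  have hdisj : ∀ s t x, x ∈ (A s : Set X) → x ∈ (A t : Set X) → s = t := by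
    intro s t x hxs hxt
    by_contra hst
    refine Set.disjoint_left.1 (disjoint_of_isLUB h𝒜 (hA s) (hA t) ?_) hxs hxt
    rintro ⟨_, _⟩ ⟨f, rfl⟩ ⟨_, _⟩ ⟨g, rfl⟩
    refine Set.disjoint_left.2 fun y hf hg => hst ?_
    have hf' : w f y / v f y = s := hf.2
    have hg' : w g y / v g y = t := hg.2
    rw [← hf', ← hg', div_eq_div_iff hf.1 hg.1, mul_comm, hcross, mul_comm]
  obtain ⟨r, hr, hrA⟩ := exists_measurable_eq_of_disjoint h𝒜 hadd (fun t => (A t).2) hdisj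
  refine ⟨LinearMap.toSpanSingleton R R ⟨r, hr⟩, fun f hf => ?_⟩
  ext x
  change v ⟨f, hf⟩ x * r x = w ⟨f, hf⟩ x
  by_cases hx : v ⟨f, hf⟩ x = 0
  · rw [hx, hzero _ _ hx, zero_mul]
  · rw [hrA (w ⟨f, hf⟩ x / v ⟨f, hf⟩ x) x, mul_div_cancel₀ _ hx]
    obtain ⟨hub, -⟩ := hA (w ⟨f, hf⟩ x / v ⟨f, hf⟩ x)
    exact hub (a := ⟨P ⟨f, hf⟩ _, hP _ _⟩) ⟨_, rfl⟩ ⟨hx, rfl⟩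

end FieldOfSets

/-- For a field of sets `𝒜` on a nonempty set `X`: the functions measurable with respect to `𝒜` form
a subring of `X → ℝ` which is a self-injective ring if and only if `𝒜` is complete and
`𝔠⁺`-additive. (The subring `R` is determined by its carrier.) -/
theorem theorem3p15 {X : Type u} [Nonempty X] (𝒜 : Set (Set X)) (h𝒜 : IsSetAlgebra 𝒜) :
    (∃ R : Subring (X → ℝ),
        (R : Set (X → ℝ)) = FieldOfSets.measurableFunctions 𝒜 ∧ FieldOfSets.IsSelfInjective R) ↔
      FieldOfSets.IsComplete 𝒜 ∧ FieldOfSets.IsSuccAdditive 𝔠 𝒜 := by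
  constructor
  · rintro ⟨R, hR, hinj⟩
    exact ⟨FieldOfSets.isComplete_of_isSelfInjective h𝒜 hR hinj,
      FieldOfSets.isSuccAdditive_of_isSelfInjective h𝒜 hR hinj⟩
  · rintro ⟨hcomp, hadd⟩
    exact ⟨FieldOfSets.measurableSubring h𝒜 hadd, rfl,
      FieldOfSets.isSelfInjective_measurableSubring h𝒜 hcomp hadd⟩
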